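/- Let $X$ be a real Banach space with topological dual $X^*$, and let $C\subseteq X$ be a closed convex set whose strong quasi relative interior $$\mathrm{sqri}(C)=\Big\{x\in C:\ \bigcup_{t\ge 0}t\,(C-x)\ \text{is a closed linear subspace of } X\Big\}$$ is nonempty. Let $F:C\times C\to\mathbb{R}$ satisfy $F(x,x)=0$ for all $x\in C$, let $F(x,\cdot)$ be convex and lower semicontinuous on $C$ for every $x\in C$, and let $F(\cdot,y)$ be concave and upper semicontinuous on $C$ for every $y\in C$. Define the set-valued operators $A^F,{}^F\!A:X\rightrightarrows X^*$ by $$A^F(x)=\{x^*\in X^*:\ F(x,y)-F(x,x)\ge\langle x^*,y-x\rangle\ \ \forall y\in C\},$$ $${}^F\!A(x)=\{x^*\in X^*:\ F(x,x)-F(y,x)\ge\langle x^*,y-x\rangle\ \ \forall y\in C\}$$ for $x\in C$, and $A^F(x)={}^F\!A(x)=\emptyset$ for $x\in X\setminus C$. Then $A^F$ is maximal monotone, that is, $\langle y^*-x^*,y-x\rangle\ge 0$ whenever $x^*\in A^F(x)$ and $y^*\in A^F(y)$, and the graph $\{(x,x^*): x^*\in A^F(x)\}$ is not properly contained in the graph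 of any monotone operator from $X$ to $X^*$. Moreover, $A^F={}^F\!A$. (It is not assumed that $F$ is monotone, i.e. that $F(x,y)+F(y,x)\le 0$.) -/

import Mathlib

namespace MonotoneBifunction

variable {X : Type*} [NormedAddCommGroup X] [NormedSpace ℝ X]

/-- The conical hull `⋃_{t ≥ 0} t • U` of a (convex) set `U`. -/
def coneHull (U : Set X) : Set X :=
  {z | ∃ t : ℝ, 0 ≤ t ∧ ∃ u ∈ U, z = t • u}

/-- The strong quasi relative interior: the points `x ∈ U` such that `cone (U - x)` is a closed
linear subspace. -/
def sqri (U : Set X) : Set X :=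
  {x | x ∈ U ∧ ∃ L : Submodule ℝ X,
    IsClosed (L : Set X) ∧ coneHull ((fun u => u - x) '' U) = (L : Set X)}

/-- The graph of a multifunction `T : X ⇉ X*`. -/
def graph (T : X → Set (StrongDual ℝ X)) : Set (X × StrongDual ℝ X) :=
  {p | p.2 ∈ T p.1}

/-- Monotone operators `T : X ⇉ X*`. -/
def IsMonotoneOperator (T : X → Set (StrongDual ℝ X)) : Prop :=
  ∀ x y : X, ∀ x' ∈ T x, ∀ y' ∈ T y, 0 ≤ (y' - x') (y - x)

/-- Maximal monotone operators: monotone operators whose graph is not properly included in the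
graph of a monotone operator. -/
def IsMaximalMonotone (T : X → Set (StrongDual ℝ X)) : Prop :=
  IsMonotoneOperator T ∧
    ∀ S : X → Set (StrongDual ℝ X), IsMonotoneOperator S → ¬ graph T ⊂ graph S

/-- The operator `A^F` of a bifunction on `C`. Only the values of `F` on `C × C` matter. -/
def rightOp (C : Set X) (F : X → X → ℝ) (x : X) : Set (StrongDual ℝ X) :=
  {x' | x ∈ C ∧ ∀ y ∈ C, x' (y - x) ≤ F x y - F x x}

/-- The operator `ᶠA` of a bifunction on `C`. Only the values of `F` on `C × C` matter. -/
def leftOp (C : Set X) (F : X → X → ℝ) (x : X) : Set (StrongDual ℝ X) :=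
  {x' | x ∈ C ∧ ∀ y ∈ C, x' (y - x) ≤ F x x - F y x}

end MonotoneBifunction

/-!
Concavity of `F · y` along a segment and lower semicontinuity of `F x ·` at its end point give
`A^F ⊆ ᶠA`; the bifunction `(x, y) ↦ -F y x` exchanges the two operators, whence equality. An
operator that is both `A^F` and `ᶠA` is monotone.

Every point of an open segment between `sqri C` and `C` again lies in `sqri C`, and by the Baire
category theorem a convex lower semicontinuous function is bounded above near such a point, inside
the closed affine subspace spanned by `C`. Hahn–Banach in that subspace extends a supporting line
of the function, if that line runs through a point of `sqri C`, to a subgradient; in particular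
`A^F` is nonempty on `sqri C`.

Let `(x₀, p)` be monotonically related to `A^F`. Testing it against elements of `A^F` along
segments issuing from a point `b ∈ C`, in directions pointing away from `x₀`, and letting the test
points tend to `b` gives `p (y - b) ≤ F b y`, because `F · y` is upper semicontinuous. For `b = x₀`
this is `p ∈ A^F x₀`. If `x₀ ∉ C`, take for `b` the first point of `C` on the way from `x₀` to a
point of `sqri C`. As the line through `x₀` and `b` enters `C` at `b`, the slope of the bound can be
lowered at will, and a subgradient whose slope along that line is smaller than that of `p`
contradicts monotonicity.
-/

namespace MonotoneBifunction

open Set Filter Topology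

section Segment

variable {V : Type*} [AddCommGroup V] [Module ℝ V] {C : Set V} {f : V → ℝ} {x y : V}

theorem convexOn_add_smul_sub_le (hf : ConvexOn ℝ C f) (hx : x ∈ C) (hy : y ∈ C) {t : ℝ}
    (ht₀ : 0 ≤ t) (ht₁ : t ≤ 1) : f (x + t • (y - x)) ≤ (1 - t) * f x + t * f y := by
  rw [show x + t • (y - x) = (1 - t) • x + t • y by module]
  simpa only [smul_eq_mul] using hf.2 hx hy (sub_nonneg.2 ht₁) ht₀ (sub_add_cancel 1 t)

theorem eventually_lt_of_convexOn_segment (hf : ConvexOn ℝ C f) (hx : x ∈ C) (hy : y ∈ C) {r : ℝ}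
    (hr : f x < r) : ∀ᶠ t in 𝓝[>] (0 : ℝ), f (x + t • (y - x)) < r := by
  have hchord : ContinuousAt (fun t : ℝ => (1 - t) * f x + t * f y) 0 := by fun_prop
  have hlt : ∀ᶠ t in 𝓝[>] (0 : ℝ), (1 - t) * f x + t * f y < r :=
    nhdsWithin_le_nhds (hchord.eventually (gt_mem_nhds (by simpa using hr)))
  filter_upwards [hlt, Ioo_mem_nhdsGT one_pos] with t ht ht01
  exact (convexOn_add_smul_sub_le hf hx hy ht01.1.le ht01.2.le).trans_lt ht

theorem le_of_convexOn_segment (hf : ConvexOn ℝ C f) (hx : x ∈ C) (hy : y ∈ C) {g : ℝ → ℝ}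
    (hg : ContinuousAt g 0) (h : ∀ t ∈ Ioo (0 : ℝ) 1, g t ≤ f (x + t • (y - x))) : g 0 ≤ f x := by
  refine le_of_forall_gt_imp_ge_of_dense fun r hr => ?_
  refine le_of_tendsto (hg.tendsto.mono_left (nhdsWithin_le_nhds (s := Ioi 0))) ?_
  filter_upwards [eventually_lt_of_convexOn_segment hf hx hy hr, Ioo_mem_nhdsGT one_pos] with t ht
    ht01
  exact (h t ht01).trans ht.le

variable [TopologicalSpace V] [ContinuousAdd V] [ContinuousSMul ℝ V]

theorem tendsto_add_smul_sub_nhdsWithin (hC : Convex ℝ C) (hx : x ∈ C) (hy : y ∈ C) :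
    Tendsto (fun t : ℝ => x + t • (y - x)) (𝓝[>] 0) (𝓝[C] x) := by
  have hcont : Continuous fun t : ℝ => x + t • (y - x) := by fun_prop
  refine tendsto_nhdsWithin_iff.2 ⟨?_, ?_⟩
  · simpa only [zero_smul, add_zero] using (hcont.tendsto 0).mono_left nhdsWithin_le_nhds
  · filter_upwards [Ioo_mem_nhdsGT one_pos] with t ht
    exact hC.add_smul_sub_mem hx hy ⟨ht.1.le, ht.2.le⟩

theorem le_of_lowerSemicontinuousOn_segment (hC : Convex ℝ C) (hf : LowerSemicontinuousOn f C)
    (hx : x ∈ C) (hy : y ∈ C) {g : ℝ → ℝ} (hg : ContinuousAt g 0)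
    (h : ∀ t ∈ Ioo (0 : ℝ) 1, f (x + t • (y - x)) ≤ g t) : f x ≤ g 0 := by
  refine le_of_forall_lt_imp_le_of_dense fun r hr => ?_
  refine ge_of_tendsto (hg.tendsto.mono_left (nhdsWithin_le_nhds (s := Ioi 0))) ?_
  filter_upwards [(tendsto_add_smul_sub_nhdsWithin hC hx hy).eventually (hf x hx r hr),
    Ioo_mem_nhdsGT one_pos] with t ht ht01
  exact ht.le.trans (h t ht01)

theorem le_of_upperSemicontinuousOn_segment (hC : Convex ℝ C) (hf : UpperSemicontinuousOn f C)
    (hx : x ∈ C) (hy : y ∈ C) {g : ℝ → ℝ} (hg : ContinuousAt g 0)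
    (h : ∀ t ∈ Ioo (0 : ℝ) 1, g t ≤ f (x + t • (y - x))) : g 0 ≤ f x := by
  have hneg := continuous_neg.comp_upperSemicontinuousOn_antitone hf fun _ _ => neg_le_neg
  exact neg_le_neg_iff.1 <| le_of_lowerSemicontinuousOn_segment hC hneg hx hy hg.neg
    fun t ht => neg_le_neg (h t ht)

theorem exists_isLeast_add_smul_sub_mem (hC : Convex ℝ C) (hclosed : IsClosed C) (hx : x ∉ C)
    (hy : y ∈ C) : ∃ τ : ℝ, 0 < τ ∧ IsLeast {t : ℝ | x + t • (y - x) ∈ C} τ := by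
  set J : Set ℝ := {t : ℝ | x + t • (y - x) ∈ C}
  have h0 : (0 : ℝ) ∉ J := by simpa [J] using hx
  have h1 : (1 : ℝ) ∈ J := by simpa [J] using hy
  have hJclosed : IsClosed J := hclosed.preimage (by fun_prop : Continuous fun t : ℝ => _)
  have hJconv : Convex ℝ J := by
    have hline : J = AffineMap.lineMap (k := ℝ) x y ⁻¹' C := by
      ext t
      simp [J, AffineMap.lineMap_apply_module', add_comm]
    exact hline ▸ hC.affine_preimage _
  have hpos : ∀ t ∈ J, 0 < t := fun t ht => by
    by_contra! ht₀
    exact h0 (hJconv.ordConnected.out ht h1 ⟨ht₀, zero_le_one⟩)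
  have hleast := hJclosed.isLeast_csInf ⟨1, h1⟩ ⟨0, fun t ht => (hpos t ht).le⟩
  exact ⟨sInf J, hpos _ hleast.1, hleast⟩

end Segment

section Epigraph

variable {V : Type*} [TopologicalSpace V] {C : Set V} {f : V → ℝ} {z : V} {m : ℝ}

theorem lt_of_mem_interior_epigraph
    (h : (z, m) ∈ interior {p : V × ℝ | p.1 ∈ C ∧ f p.1 ≤ p.2}) : f z < m := by
  have hcont : ContinuousAt (fun r : ℝ => (z, r)) m := by fun_prop
  have hnear := hcont.eventually (mem_interior_iff_mem_nhds.1 h)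
  obtain ⟨r, hr, hrm⟩ := ((hnear.filter_mono nhdsWithin_le_nhds).and
    (self_mem_nhdsWithin (s := Iio m))).exists
  exact hr.2.trans_lt hrm

theorem mem_interior_epigraph {r : ℝ} (h : ∀ᶠ y in 𝓝 z, y ∈ C ∧ f y ≤ r) (hm : r < m) :
    (z, m) ∈ interior {p : V × ℝ | p.1 ∈ C ∧ f p.1 ≤ p.2} := by
  rw [mem_interior_iff_mem_nhds, nhds_prod_eq]
  filter_upwards [h.prod_mk (lt_mem_nhds hm)] with p hp
  exact ⟨hp.1.1, hp.1.2.trans hp.2.le⟩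

end Epigraph

theorem apply_eq_zero_of_forall_le {M : Type*} [AddCommGroup M] [Module ℝ M] {φ : M →ₗ[ℝ] ℝ}
    {a : ℝ} (h : ∀ z, a ≤ φ z) (z : M) : φ z = 0 := by
  by_contra hz
  have := h (((a - 1) / φ z) • z)
  rw [map_smul, smul_eq_mul, div_mul_cancel₀ _ hz] at this
  linarith

theorem exists_strongDual_eq_one_of_notMem {V : Type*} [AddCommGroup V] [Module ℝ V]
    [TopologicalSpace V] [IsTopologicalAddGroup V] [ContinuousSMul ℝ V] [LocallyConvexSpace ℝ V]
    {L : Submodule ℝ V} (hL : IsClosed (L : Set V)) {v : V} (hv : v ∉ L) :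
    ∃ n : StrongDual ℝ V, n v = 1 ∧ ∀ l ∈ L, n l = 0 := by
  obtain ⟨n, u, hnL, hn⟩ := geometric_hahn_banach_closed_point L.convex hL hv
  have hu : 0 < u := by simpa using hnL 0 L.zero_mem
  have hzero : ∀ l : L, -n l = 0 :=
    apply_eq_zero_of_forall_le (φ := -(n.toLinearMap ∘ₗ L.subtype)) (a := -u)
      fun l => neg_le_neg (hnL l l.2).le
  refine ⟨(n v)⁻¹ • n, by simp [(hu.trans hn).ne'], fun l hl => ?_⟩
  simp [neg_eq_zero.1 (hzero ⟨l, hl⟩)]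

theorem exists_strongDual_eq_zero_of_disjoint_interior {W : Type*} [AddCommGroup W] [Module ℝ W]
    [TopologicalSpace W] [IsTopologicalAddGroup W] [ContinuousSMul ℝ W] {S : Set W}
    (hS : Convex ℝ S) (hne : (interior S).Nonempty) {M : Submodule ℝ W} {a : W}
    (hM : ∀ m ∈ M, a + m ∉ interior S) :
    ∃ φ : StrongDual ℝ W, (∀ m ∈ M, φ m = 0) ∧ (∀ z ∈ interior S, φ z < φ a) ∧
      ∀ z ∈ S, φ z ≤ φ a := by
  have hdisj : Disjoint (interior S) ((fun m => a + m) '' M) := by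
    rw [Set.disjoint_right]
    rintro - ⟨m, hm, rfl⟩
    exact hM m hm
  obtain ⟨φ, u, hlt, hge⟩ :=
    geometric_hahn_banach_open hS.interior isOpen_interior (M.convex.translate a) hdisj
  have hge' : ∀ m ∈ M, u ≤ φ a + φ m := fun m hm => map_add φ a m ▸ hge _ ⟨m, hm, rfl⟩
  have hua : u ≤ φ a := by simpa using hge' 0 M.zero_mem
  have hzero : ∀ m : M, φ m = 0 :=
    apply_eq_zero_of_forall_le (φ := φ.toLinearMap ∘ₗ M.subtype) (a := u - φ a)
      fun m => sub_le_iff_le_add'.2 (hge' m m.2)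
  refine ⟨φ, fun m hm => hzero ⟨m, hm⟩, fun z hz => (hlt z hz).trans_le hua, fun z hz => ?_⟩
  refine closure_minimal (fun w hw => ((hlt w hw).trans_le hua).le)
    (isClosed_Iic.preimage φ.continuous) ?_
  rw [hS.closure_interior_eq_closure_of_nonempty_interior hne]
  exact subset_closure hz

section Subdifferential

variable {V : Type*} [AddCommGroup V] [Module ℝ V] [TopologicalSpace V]

/-- The subdifferential at `x ∈ C` of the function equal to `f` on `C` and to `+∞` off `C`. The
condition `x ∈ C` is not part of the definition. -/
def subdifferential (C : Set V) (f : V → ℝ) (x : V) : Set (StrongDual ℝ V) :=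
  {q | ∀ y ∈ C, q (y - x) ≤ f y - f x}

variable [IsTopologicalAddGroup V] [ContinuousSMul ℝ V] {C : Set V} {f : V → ℝ}

section ChainRule

variable {E : Type*} [AddCommGroup E] [Module ℝ E] {T : E →ₗ[ℝ] V} {ℓ : E →ₗ[ℝ] ℝ} {x : V} {e₀ : E}
  {r : ℝ}

theorem exists_separating_epigraph (hf : ConvexOn ℝ C f)
    (hℓ : ∀ e, x + T e ∈ C → f x + ℓ e ≤ f (x + T e))
    (hbdd : ∀ᶠ y in 𝓝 (x + T e₀), y ∈ C ∧ f y ≤ r) :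
    ∃ φ : StrongDual ℝ (V × ℝ), φ (0, 1) < 0 ∧ (∀ e, φ (T e, ℓ e) = 0) ∧
      ∀ y ∈ C, φ (y, f y) ≤ φ (x, f x) := by
  have hint := mem_interior_epigraph hbdd (lt_add_one r)
  have hbelow : ∀ m ∈ LinearMap.range (T.prod ℓ),
      (x, f x) + m ∉ interior {p : V × ℝ | p.1 ∈ C ∧ f p.1 ≤ p.2} := by
    rintro - ⟨e, rfl⟩ hp
    exact (lt_of_mem_interior_epigraph hp).not_ge (hℓ e (interior_subset hp).1)
  obtain ⟨φ, hzero, hlt, hle⟩ :=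
    exists_strongDual_eq_zero_of_disjoint_interior hf.convex_epigraph ⟨_, hint⟩ hbelow
  have hφ : ∀ e, φ (T e, ℓ e) = 0 := fun e => hzero _ ⟨e, rfl⟩
  refine ⟨φ, ?_, hφ, fun y hy => hle (y, f y) ⟨hy, le_rfl⟩⟩
  set δ : ℝ := r + 1 - (f x + ℓ e₀) with hδ
  have hδ₀ : 0 < δ := by
    obtain ⟨hmem, hfr⟩ := hbdd.self_of_nhds
    linarith [hℓ e₀ hmem]
  have hdrop : φ (δ • (0, 1)) < 0 := by
    have hsum : ((x + T e₀, r + 1) : V × ℝ) = (x, f x) + (T e₀, ℓ e₀) + δ • (0, 1) := by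
      ext <;> simp [hδ]
    have h := hlt _ hint
    rw [hsum, map_add, map_add, hφ] at h
    linarith
  rw [map_smul, smul_eq_mul] at hdrop
  exact neg_of_mul_neg_right hdrop hδ₀.le

theorem exists_mem_subdifferential_comp_eq (hf : ConvexOn ℝ C f)
    (hℓ : ∀ e, x + T e ∈ C → f x + ℓ e ≤ f (x + T e))
    (hbdd : ∀ᶠ y in 𝓝 (x + T e₀), y ∈ C ∧ f y ≤ r) :
    ∃ q ∈ subdifferential C f x, ∀ e, q (T e) = ℓ e := by
  obtain ⟨φ, hneg, hφ, hmax⟩ := exists_separating_epigraph hf hℓ hbdd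
  set β : ℝ := -φ (0, 1)
  have hβ : 0 < β := neg_pos.2 hneg
  set ψ : StrongDual ℝ V := φ.comp (ContinuousLinearMap.inl ℝ V ℝ)
  have hsplit : ∀ z m, φ (z, m) = ψ z - β * m := fun z m => by
    have : ((z, m) : V × ℝ) = (z, 0) + m • (0, 1) := by simp
    rw [this, map_add, map_smul]
    simp [ψ, β, mul_comm]
  refine ⟨β⁻¹ • ψ, fun y hy => ?_, fun e => ?_⟩
  · have := hmax y hy
    rw [hsplit, hsplit] at this
    rw [smul_apply, smul_eq_mul, inv_mul_le_iff₀ hβ, map_sub]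
    linarith
  · have := hφ e
    rw [hsplit, sub_eq_zero] at this
    rw [smul_apply, smul_eq_mul, this, inv_mul_cancel_left₀ hβ.ne']

end ChainRule

variable [BaireSpace V] {c : V}

theorem mem_nhds_of_convex_of_isClosed_of_absorbing {S : Set V} (hconv : Convex ℝ S)
    (hclosed : IsClosed S) (habs : ∀ v : V, ∃ t : ℝ, 0 < t ∧ c + t • v ∈ S) : S ∈ 𝓝 c := by
  have hc : c ∈ S := by
    obtain ⟨t, -, ht⟩ := habs 0
    simpa using ht
  have hcover : ⋃ n : ℕ, {v : V | c + (1 / ((n : ℝ) + 1)) • v ∈ S} = univ := by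
    refine eq_univ_of_forall fun v => mem_iUnion.2 ?_
    obtain ⟨t, ht, hv⟩ := habs v
    obtain ⟨n, hn⟩ := exists_nat_one_div_lt ht
    have hn' : (0 : ℝ) ≤ 1 / ((n : ℝ) + 1) / t := by positivity
    have h := hconv.add_smul_sub_mem hc hv ⟨hn', (div_le_one ht).2 hn.le⟩
    rw [add_sub_cancel_left, smul_smul, div_mul_cancel₀ _ ht.ne'] at h
    exact ⟨n, h⟩
  obtain ⟨n, v, hv⟩ := nonempty_interior_of_iUnion_of_closed
    (fun n : ℕ => hclosed.preimage (by fun_prop : Continuous fun v : V => _)) hcover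
  set s : ℝ := 1 / ((n : ℝ) + 1)
  have hs : 0 < s := by positivity
  have hinterior : c + s • v ∈ interior S := by
    let scale := (Homeomorph.smulOfNeZero s hs.ne').trans (Homeomorph.addLeft c)
    exact (scale.preimage_interior S).superset hv
  obtain ⟨t, ht, hopposite⟩ := habs (-v)
  have h := hconv.combo_interior_self_mem_interior hinterior hopposite (a := t / (s + t))
    (b := s / (s + t)) (by positivity) (by positivity) (by field_simp; ring)
  have hcombo : (t / (s + t)) • (c + s • v) + (s / (s + t)) • (c + t • -v) = c := by
    match_scalars <;> field_simp <;> ring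
  rw [hcombo] at h
  exact mem_interior_iff_mem_nhds.1 h

theorem eventually_mem_and_le_of_absorbing (hC : IsClosed C) (hf : ConvexOn ℝ C f)
    (hlsc : LowerSemicontinuousOn f C) (habs : ∀ v : V, ∃ t : ℝ, 0 < t ∧ c + t • v ∈ C) {r : ℝ}
    (hr : f c < r) : ∀ᶠ y in 𝓝 c, y ∈ C ∧ f y ≤ r := by
  have hc : c ∈ C := by
    obtain ⟨t, -, ht⟩ := habs 0
    simpa using ht
  have hclosed : IsClosed {y | y ∈ C ∧ f y ≤ r} := by
    obtain ⟨K, hK, hCK⟩ := lowerSemicontinuousOn_iff_preimage_Iic.1 hlsc r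
    have hinter : {y | y ∈ C ∧ f y ≤ r} = C ∩ K := hCK
    exact hinter ▸ hC.inter hK
  refine mem_nhds_of_convex_of_isClosed_of_absorbing (hf.convex_le r) hclosed fun v => ?_
  obtain ⟨t, ht, hv⟩ := habs v
  obtain ⟨s, hlt, hs⟩ := ((eventually_lt_of_convexOn_segment hf hc hv hr).and
    (Ioo_mem_nhdsGT one_pos)).exists
  have hmem := hf.1.add_smul_sub_mem hc hv ⟨hs.1.le, hs.2.le⟩
  rw [add_sub_cancel_left, smul_smul] at hlt hmem
  exact ⟨s * t, mul_pos hs.1 ht, hmem, hlt.le⟩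

end Subdifferential

section StrongQuasiRelativeInterior

variable {X : Type*} [NormedAddCommGroup X] [NormedSpace ℝ X] {C : Set X} {f : X → ℝ} {c x : X}

theorem mem_sqri_iff : c ∈ sqri C ↔ ∃ L : Submodule ℝ X, IsClosed (L : Set X) ∧
    (∀ y ∈ C, y - c ∈ L) ∧ ∀ v ∈ L, ∃ t : ℝ, 0 < t ∧ c + t • v ∈ C := by
  constructor
  · rintro ⟨hc, L, hL, hcone⟩
    refine ⟨L, hL, fun y hy => ?_, fun v hv => ?_⟩
    · exact hcone.subset ⟨1, zero_le_one, y - c, ⟨y, hy, rfl⟩, (one_smul ℝ _).symm⟩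
    · obtain ⟨t, ht, -, ⟨u, hu, rfl⟩, rfl⟩ := hcone.superset hv
      rcases ht.eq_or_lt with rfl | ht
      · exact ⟨1, one_pos, by simpa using hc⟩
      · exact ⟨t⁻¹, inv_pos.2 ht, by simpa [smul_smul, inv_mul_cancel₀ ht.ne'] using hu⟩
  · rintro ⟨L, hL, hsub, habs⟩
    obtain ⟨t, -, hc⟩ := habs 0 L.zero_mem
    refine ⟨by simpa using hc, L, hL, Subset.antisymm ?_ fun v hv => ?_⟩
    · rintro - ⟨t, -, -, ⟨y, hy, rfl⟩, rfl⟩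
      exact L.smul_mem t (hsub y hy)
    · obtain ⟨t, ht, hmem⟩ := habs v hv
      exact ⟨t⁻¹, (inv_pos.2 ht).le, t • v, ⟨_, hmem, add_sub_cancel_left _ _⟩,
        (inv_smul_smul₀ ht.ne' v).symm⟩

theorem add_smul_sub_mem_sqri (hC : Convex ℝ C) (hx : x ∈ C) (hc : c ∈ sqri C) {s : ℝ}
    (hs₀ : 0 < s) (hs₁ : s ≤ 1) : x + s • (c - x) ∈ sqri C := by
  obtain ⟨L, hL, hsub, habs⟩ := mem_sqri_iff.1 hc
  refine mem_sqri_iff.2 ⟨L, hL, fun y hy => ?_, fun v hv => ?_⟩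
  · rw [show y - (x + s • (c - x)) = (y - c) - (1 - s) • (x - c) by module]
    exact L.sub_mem (hsub y hy) (L.smul_mem _ (hsub x hx))
  · obtain ⟨t, ht, hmem⟩ := habs v hv
    refine ⟨s * t, mul_pos hs₀ ht, ?_⟩
    rw [show x + s • (c - x) + (s * t) • v = x + s • (c + t • v - x) by module]
    exact hC.add_smul_sub_mem hx hmem ⟨hs₀.le, hs₁⟩

variable [CompleteSpace X]

theorem exists_mem_subdifferential_comp_eq_of_submodule (hC : IsClosed C)
    (hf : ConvexOn ℝ C f) (hlsc : LowerSemicontinuousOn f C) (hx : x ∈ C)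
    {L : Submodule ℝ X} (hL : IsClosed (L : Set X)) (hsub : ∀ y ∈ C, y - c ∈ L)
    (habs : ∀ v ∈ L, ∃ t : ℝ, 0 < t ∧ c + t • v ∈ C) {E : Type*} [AddCommGroup E] [Module ℝ E]
    {T : E →ₗ[ℝ] L} {ℓ : E →ₗ[ℝ] ℝ} {e₀ : E} (he₀ : x + T e₀ = c)
    (hℓ : ∀ e, x + T e ∈ C → f x + ℓ e ≤ f (x + T e)) :
    ∃ q ∈ subdifferential C f x, ∀ e, q (T e) = ℓ e := by
  have : CompleteSpace L := hL.completeSpace_coe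
  have hmem : ∀ y ∈ C, y - x ∈ L := fun y hy => by
    simpa using L.sub_mem (hsub y hy) (hsub x hx)
  let A : L →ᵃ[ℝ] X := AffineMap.const ℝ L x + L.subtype.toAffineMap
  have hA : ∀ l : L, A l = x + l := fun l => rfl
  have hAcont : Continuous A := (by fun_prop : Continuous fun l : L => x + (l : X))
  have hbdd : ∀ᶠ l in 𝓝 (0 + T e₀), l ∈ A ⁻¹' C ∧ (f ∘ A) l ≤ f c + 1 := by
    refine eventually_mem_and_le_of_absorbing (hC.preimage hAcont) (hf.comp_affineMap A)
      (hlsc.comp hAcont.continuousOn (mapsTo_preimage A C)) (fun v => ?_) ?_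
    · simpa [hA, ← add_assoc, he₀] using habs v v.2
    · simp [hA, he₀]
  obtain ⟨q', hq', hq'T⟩ := exists_mem_subdifferential_comp_eq (hf.comp_affineMap A) (x := 0)
    (T := T)
    (ℓ := ℓ) (fun e he => by simpa [hA] using hℓ e (by simpa [hA] using he)) hbdd
  obtain ⟨q, hq, -⟩ := exists_extension_norm_eq L q'
  refine ⟨q, fun y hy => ?_, fun e => (hq _).trans (hq'T e)⟩
  have := hq' ⟨y - x, hmem y hy⟩ (by simpa [hA] using hy)
  rw [sub_zero, ← hq] at this
  simpa [hA] using this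

theorem exists_mem_subdifferential_apply_eq (hC : IsClosed C) (hf : ConvexOn ℝ C f)
    (hlsc : LowerSemicontinuousOn f C) (hx : x ∈ C) (hc : c ∈ sqri C) {v : X} {γ κ : ℝ}
    (hγ : x + γ • v = c) (hκ : ∀ s : ℝ, x + s • v ∈ C → f x + s * κ ≤ f (x + s • v)) :
    ∃ q ∈ subdifferential C f x, q v = κ := by
  obtain ⟨L, hL, hsub, habs⟩ := mem_sqri_iff.1 hc
  by_cases hv : v ∈ L
  · obtain ⟨q, hq, hqv⟩ := exists_mem_subdifferential_comp_eq_of_submodule hC hf hlsc hx hL hsub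
      habs (T := LinearMap.toSpanSingleton ℝ L ⟨v, hv⟩)
      (ℓ := LinearMap.toSpanSingleton ℝ ℝ κ) hγ hκ
    exact ⟨q, hq, by simpa using hqv 1⟩
  · -- The line meets `C` only at `x`, so a functional vanishing on `L` can adjust the slope.
    obtain rfl : x = c := by
      have hγv : γ • v ∈ L := by simpa [← hγ] using L.neg_mem (hsub x hx)
      have hγ₀ : γ = 0 := by
        by_contra hne
        exact hv ((L.smul_mem_iff hne).1 hγv)
      simpa [hγ₀] using hγ
    obtain ⟨q, hq, -⟩ := exists_mem_subdifferential_comp_eq_of_submodule hC hf hlsc hx hL hsub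
      habs (T := (0 : ℝ →ₗ[ℝ] L)) (ℓ := 0) (e₀ := 0) (by simp) (by simp)
    obtain ⟨n, hnv, hnL⟩ := exists_strongDual_eq_one_of_notMem hL hv
    refine ⟨q + (κ - q v) • n, fun y hy => ?_, by simp [hnv]⟩
    simpa [hnL _ (hsub y hy)] using hq y hy

end StrongQuasiRelativeInterior

section Monotone

variable {X : Type*} [NormedAddCommGroup X] [NormedSpace ℝ X] {T : X → Set (StrongDual ℝ X)}

/-- The pair `(x₀, p)` is monotonically related to the operator `T`: adjoining it to the graph of
a monotone operator `T` leaves the operator monotone. -/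
def IsMonotonicallyRelated (T : X → Set (StrongDual ℝ X)) (x₀ : X) (p : StrongDual ℝ X) : Prop :=
  ∀ x, ∀ q ∈ T x, 0 ≤ (q - p) (x - x₀)

theorem IsMonotoneOperator.isMaximalMonotone (hT : IsMonotoneOperator T)
    (hmax : ∀ x₀ p, IsMonotonicallyRelated T x₀ p → p ∈ T x₀) : IsMaximalMonotone T := by
  refine ⟨hT, fun S hS hTS => hTS.2 fun ⟨x₀, p⟩ hp => hmax x₀ p fun x q hq => ?_⟩
  exact hS x₀ x p hp q (hTS.1 (show (x, q) ∈ graph T from hq))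

end Monotone

section Bifunction

variable {X : Type*} [NormedAddCommGroup X] [NormedSpace ℝ X] {C : Set X} {F : X → X → ℝ}

theorem leftOp_eq_rightOp_swap : leftOp C F = rightOp C fun x y => -F y x := by
  ext x q
  simp only [leftOp, rightOp, mem_ofPred_eq, neg_sub_neg]

theorem rightOp_subset_leftOp (hdiag : ∀ x ∈ C, F x x = 0)
    (hlsc : ∀ x ∈ C, LowerSemicontinuousOn (fun y => F x y) C)
    (hconcave : ∀ y ∈ C, ConcaveOn ℝ C fun x => F x y) (x : X) :
    rightOp C F x ⊆ leftOp C F x := by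
  rintro q ⟨hx, hq⟩
  refine ⟨hx, fun y hy => ?_⟩
  have hC := (hconcave x hx).1
  suffices h : F y x ≤ -((1 - 0) * q (y - x)) by linarith [hdiag x hx]
  refine le_of_lowerSemicontinuousOn_segment hC (hlsc y hy) hx hy
    (g := fun t => -((1 - t) * q (y - x))) (by fun_prop) fun t ht => ?_
  set z := x + t • (y - x) with hzdef
  have hz : z ∈ C := hC.add_smul_sub_mem hx hy ⟨ht.1.le, ht.2.le⟩
  have hsubgradient : t * q (y - x) ≤ F x z := by
    simpa [hzdef, hdiag x hx] using hq z hz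
  have hchord : (1 - t) * F x z + t * F y z ≤ 0 := by
    have h := convexOn_add_smul_sub_le (hconcave z hz).neg hx hy ht.1.le ht.2.le
    simp only [Pi.neg_apply, ← hzdef, hdiag z hz] at h
    linarith
  have hscaled := mul_le_mul_of_nonneg_left hsubgradient (sub_nonneg.2 ht.2.le)
  exact le_of_mul_le_mul_left (by linarith) ht.1

theorem rightOp_eq_leftOp (hdiag : ∀ x ∈ C, F x x = 0)
    (hconvex : ∀ x ∈ C, ConvexOn ℝ C fun y => F x y)
    (hlsc : ∀ x ∈ C, LowerSemicontinuousOn (fun y => F x y) C)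
    (hconcave : ∀ y ∈ C, ConcaveOn ℝ C fun x => F x y)
    (husc : ∀ y ∈ C, UpperSemicontinuousOn (fun x => F x y) C) :
    rightOp C F = leftOp C F := by
  funext x
  refine (rightOp_subset_leftOp hdiag hlsc hconcave x).antisymm ?_
  have hswap := rightOp_subset_leftOp (F := fun x y => -F y x) (by simpa using hdiag)
    (fun y hy => continuous_neg.comp_upperSemicontinuousOn_antitone (husc y hy)
      fun _ _ => neg_le_neg) (fun y hy => (hconvex y hy).neg) x
  simpa only [leftOp_eq_rightOp_swap, neg_neg] using hswap

theorem isMonotoneOperator_rightOp (heq : rightOp C F = leftOp C F) :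
    IsMonotoneOperator (rightOp C F) := by
  intro x y p hp q hq
  have hpr : p (y - x) ≤ F x y - F x x := hp.2 y hq.1
  have hql : q (x - y) ≤ F y y - F x y := (heq ▸ hq).2 x hp.1
  have hpl : p (y - x) ≤ F x x - F y x := (heq ▸ hp).2 y hq.1
  have hqr : q (x - y) ≤ F y x - F y y := hq.2 x hp.1
  rw [← neg_sub y x, map_neg] at hql hqr
  rw [sub_apply]
  linarith

theorem rightOp_nonempty_of_mem_sqri [CompleteSpace X] {x : X} (hC : IsClosed C)
    (hconvex : ConvexOn ℝ C fun y => F x y) (hlsc : LowerSemicontinuousOn (fun y => F x y) C)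
    (hx : x ∈ sqri C) : (rightOp C F x).Nonempty := by
  obtain ⟨q, hq, -⟩ := exists_mem_subdifferential_apply_eq hC hconvex hlsc hx.1 hx
    (v := 0) (γ := 0) (κ := 0) (by simp) (by simp)
  exact ⟨q, hx.1, hq⟩

section MonotonicallyRelated

variable [CompleteSpace X] {x₀ b c d y : X} {p : StrongDual ℝ X} (hC : IsClosed C)
  (hdiag : ∀ x ∈ C, F x x = 0) (hconvex : ∀ x ∈ C, ConvexOn ℝ C fun y => F x y)
  (hlsc : ∀ x ∈ C, LowerSemicontinuousOn (fun y => F x y) C)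
  (husc : ∀ y ∈ C, UpperSemicontinuousOn (fun x => F x y) C)
include hC hdiag hconvex hlsc husc

theorem le_of_isMonotonicallyRelated_of_mem_sqri
    (hp : IsMonotonicallyRelated (rightOp C F) x₀ p) (hb : b ∈ C) (hd : d ∈ sqri C)
    (hray : SameRay ℝ (b - x₀) (d - b)) : p (d - b) ≤ F b d := by
  rcases eq_or_ne d b with rfl | hne
  · simp [hdiag d hb]
  obtain ⟨μ, hμ, hμb⟩ := hray.symm.exists_nonneg_left (sub_ne_zero.2 hne)
  have hconv := (hconvex b hb).1
  suffices h : (1 - 0) * p (d - b) ≤ F b d by simpa using h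
  refine le_of_upperSemicontinuousOn_segment hconv (husc d hd.1) hb hd.1
    (g := fun t => (1 - t) * p (d - b)) (by fun_prop) fun t ht => ?_
  set x := b + t • (d - b) with hxdef
  have hx : x ∈ sqri C := add_smul_sub_mem_sqri hconv hb hd ht.1 ht.2.le
  obtain ⟨q, hq⟩ := rightOp_nonempty_of_mem_sqri hC (hconvex x hx.1) (hlsc x hx.1) hx
  have hpq : p (d - b) ≤ q (d - b) := by
    have hdir : x - x₀ = (t + μ) • (d - b) := by
      rw [add_smul, hμb, hxdef]
      abel
    have h := hp x q hq
    rw [hdir, map_smul, smul_eq_mul, sub_apply] at h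
    exact sub_nonneg.1 (nonneg_of_mul_nonneg_right h (by linarith [ht.1]))
  calc (1 - t) * p (d - b) ≤ (1 - t) * q (d - b) :=
        mul_le_mul_of_nonneg_left hpq (sub_nonneg.2 ht.2.le)
    _ = q (d - x) := by
        rw [show d - x = (1 - t) • (d - b) by rw [hxdef]; module, map_smul, smul_eq_mul]
    _ ≤ F x d := by simpa [hdiag x hx.1] using hq.2 d hd.1

theorem le_of_isMonotonicallyRelated
    (hp : IsMonotonicallyRelated (rightOp C F) x₀ p) (hc : c ∈ sqri C) (hb : b ∈ C) (hy : y ∈ C)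
    (hbc : SameRay ℝ (b - x₀) (c - b)) (hby : SameRay ℝ (b - x₀) (y - b)) :
    p (y - b) ≤ F b y := by
  suffices h : p (y + (0 : ℝ) • (c - y) - b) ≤ F b y by simpa using h
  refine le_of_convexOn_segment (hconvex b hb) hy hc.1
    (g := fun s => p (y + s • (c - y) - b)) (by fun_prop) fun s hs => ?_
  have hd : y + s • (c - y) ∈ sqri C :=
    add_smul_sub_mem_sqri (hconvex b hb).1 hy hc hs.1 hs.2.le
  refine le_of_isMonotonicallyRelated_of_mem_sqri hC hdiag hconvex hlsc husc hp hb hd ?_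
  rw [show y + s • (c - y) - b = (1 - s) • (y - b) + s • (c - b) by module]
  exact (hby.nonneg_smul_right (sub_nonneg.2 hs.2.le)).add_right (hbc.nonneg_smul_right hs.1.le)

theorem mem_of_isMonotonicallyRelated
    (hp : IsMonotonicallyRelated (rightOp C F) x₀ p) (hc : c ∈ sqri C) : x₀ ∈ C := by
  by_contra hx₀
  obtain ⟨τ, hτ, hbC, hleast⟩ :=
    exists_isLeast_add_smul_sub_mem (hconvex c hc.1).1 hC hx₀ hc.1
  have hτ₁ : τ ≤ 1 := hleast (by simpa using hc.1)
  set v := c - x₀ with hv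
  set b := x₀ + τ • v with hbdef
  have hbx₀ : b - x₀ = τ • v := add_sub_cancel_left _ _
  have hγ : b + (1 - τ) • v = c := by
    rw [hbdef, hv]
    module
  have hray : ∀ r : ℝ, 0 ≤ r → SameRay ℝ (b - x₀) (b + r • v - b) := fun r hr => by
    rw [hbx₀, add_sub_cancel_left]
    exact (SameRay.sameRay_nonneg_smul_left v hτ.le).nonneg_smul_right hr
  have hbound : ∀ r : ℝ, b + r • v ∈ C → F b b + r * (p v - 1) ≤ F b (b + r • v) := by
    intro r hr
    have hr₀ : 0 ≤ r := by
      have hmem : x₀ + (τ + r) • v ∈ C := by rwa [add_smul, ← add_assoc]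
      linarith [hleast hmem]
    have h := le_of_isMonotonicallyRelated hC hdiag hconvex hlsc husc hp hc hbC hr
      (hγ ▸ hray _ (sub_nonneg.2 hτ₁)) (hray r hr₀)
    rw [add_sub_cancel_left, map_smul, smul_eq_mul] at h
    linarith [hdiag b hbC]
  obtain ⟨q, hq, hqv⟩ :=
    exists_mem_subdifferential_apply_eq hC (hconvex b hbC) (hlsc b hbC) hbC hc hγ hbound
  have hmono := hp b q ⟨hbC, hq⟩
  rw [hbx₀, map_smul, sub_apply, hqv, smul_eq_mul] at hmono
  linarith

theorem mem_rightOp_of_isMonotonicallyRelated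
    (hp : IsMonotonicallyRelated (rightOp C F) x₀ p) (hc : c ∈ sqri C) : p ∈ rightOp C F x₀ := by
  have hx₀ := mem_of_isMonotonicallyRelated hC hdiag hconvex hlsc husc hp hc
  have hray : ∀ v, SameRay ℝ (x₀ - x₀) v := fun v => by simp
  refine ⟨hx₀, fun y hy => ?_⟩
  simpa [hdiag x₀ hx₀] using
    le_of_isMonotonicallyRelated hC hdiag hconvex hlsc husc hp hc hx₀ hy (hray _) (hray _)

end MonotonicallyRelated

end Bifunction

end MonotoneBifunction

theorem mainTheorem1 {X : Type*} [NormedAddCommGroup X] [NormedSpace ℝ X] [CompleteSpace X]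
    (C : Set X) (hCconv : Convex ℝ C) (hCclosed : IsClosed C)
    (hCsqri : (MonotoneBifunction.sqri C).Nonempty)
    (F : X → X → ℝ)
    (hFdiag : ∀ x ∈ C, F x x = 0)
    (hFconvex : ∀ x ∈ C, ConvexOn ℝ C (fun y => F x y))
    (hFlsc : ∀ x ∈ C, LowerSemicontinuousOn (fun y => F x y) C)
    (hFconcave : ∀ y ∈ C, ConcaveOn ℝ C (fun x => F x y))
    (hFusc : ∀ y ∈ C, UpperSemicontinuousOn (fun x => F x y) C) :
    MonotoneBifunction.IsMaximalMonotone (MonotoneBifunction.rightOp C F) ∧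
      MonotoneBifunction.rightOp C F = MonotoneBifunction.leftOp C F := by
  obtain ⟨c, hc⟩ := hCsqri
  have heq := MonotoneBifunction.rightOp_eq_leftOp hFdiag hFconvex hFlsc hFconcave hFusc
  refine ⟨(MonotoneBifunction.isMonotoneOperator_rightOp heq).isMaximalMonotone ?_, heq⟩
  intro x₀ p hp
  exact MonotoneBifunction.mem_rightOp_of_isMonotonicallyRelated hCclosed hFdiag hFconvex hFlsc
    hFusc hp hc
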